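/- **Setting.** A two-player zero-sum imperfect-information extensive-form game (IIEFG) with horizon $H$ is a partially observable Markov game with finite layered state space $\mathcal S=\bigcup_{h\le H}\mathcal S_h$, infosets $\mathcal X=\bigcup_h\mathcal X_h$ and $\mathcal Y=\bigcup_h\mathcal Y_h$ of the max- and the min-player with emission functions $x:\mathcal S_h\to\mathcal X_h$, $y:\mathcal S_h\to\mathcal Y_h$, action sets $\mathcal A,\mathcal B$ of sizes $A,B$, an initial law $p_0$ on $\mathcal S_1$, transitions $p_h(\cdot\mid s_h,a_h,b_h)$ on $\mathcal S_{h+1}$ and random rewards $r_h(s_h,a_h,b_h)\in[0,1]$. It has tree structure (each state is reached by exactly one history of states and actions) and perfect recall (each infoset of a player is reached by exactly one history of that player's infosets and actions). Let $X=|\mathcal X|$, $Y=|\mathcal Y|$. Policies $\mu$, $\nu$ assign a distribution over $\mathcal A$, resp. $\mathcal B$, to each infoset of the respective player; $\Pi_{\max}$, $\Pi_{\min}$ are the sets of policies; $V^{\mu,\nu}=\mathbb E_{\mu,\nu}[\sum_{h=1}^H r_h]$, and $\mathrm{NEGap}(\mu,\nu)=\max_{\mu^\dagger\in\Pi_{\max}}V^{\mu^\dagger,\nu}-\min_{\nu^\dagger\in\Pi_{\min}}V^{\mu,\nu^\dagger}$.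 A (possibly randomized) algorithm for the max-player chooses $\mu^t$ from the trajectories $(x_h,a_h,r_h)_{h\le H}$ that the max-player observed in the episodes before $t$; its regret against opponent policies $\nu^1,\dots,\nu^T$ is $\mathfrak R^T=\max_{\mu^\dagger\in\Pi_{\max}}\sum_{t=1}^T(V^{\mu^\dagger,\nu^t}-V^{\mu^t,\nu^t})$. An algorithm that controls both players chooses $(\mu^t,\nu^t)$, and after $T$ episodes a pair $(\hat\mu,\hat\nu)\in\Pi_{\max}\times\Pi_{\min}$, from the observed $(x_h,y_h,a_h,b_h,r_h)_{h\le H}$ of the previous episodes. **Theorem (lower bound for learning IIEFGs).** There is an absolute constant $c>0$ such that the following holds for all $A\ge2$ and $H\ge1$. (a) (Regret.) There are $\mathcal S,\mathcal X,\mathcal Y$, emission functions, an initial law and transitions, with $B=1$ and $X=\sum_{h=1}^{H}A^{h-1}$, satisfying tree structure and perfect recall, such that for every $T\ge XA$ and every algorithm for the max-player there are rewards for which the resulting game satisfies $$\mathbb E[\mathfrak R^T]\ \ge\ c\sqrt{XAT}.$$ (b) (PAC learning of Nash equilibria.) For every $B\ge1$ there are $\mathcal S,\mathcal X,\mathcal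 Y$, emission functions, an initial law and transitions, with $X=\sum_{h=1}^{H}A^{h-1}$ and $Y=\sum_{h=1}^{H}B^{h-1}$, satisfying tree structure and perfect recall, such that for every $T\ge0$, every algorithm that controls both players and outputs $(\hat\mu,\hat\nu)$ after $T$ episodes, and every $\varepsilon\in(0,1/2]$, there are rewards for which the resulting game satisfies $$\mathbb E[\mathrm{NEGap}(\hat\mu,\hat\nu)]\ \ge\ \varepsilon,\qquad\text{unless}\qquad T\ \ge\ \frac{c\,(XA+YB)}{\varepsilon^2}.$$ -/

import Mathlib

noncomputable section

/-- A (behavioural) policy: a probability distribution over actions at every infoset. -/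
abbrev Policy (I A : Type) : Type := I → PMF A

/-- The expectation of a real function under a discrete law. -/
def PMF.expect {α : Type} (p : PMF α) (f : α → ℝ) : ℝ := ∑' x, (p x).toReal * f x

/-- A finite-horizon two-player partially observable Markov game, without its rewards:
the layers of states and infosets, the two emission functions, and the transitions. -/
structure GameForm (H : ℕ) (S X Y A B : Type) where
  /-- The step at which a state occurs (steps are numbered from `0` to `H - 1`). -/
  layer : S → Fin H
  /-- The step at which an infoset of the max-player occurs. -/
  layerX : X → Fin H
  /-- The step at which an infoset of the min-player occurs. -/
  layerY : Y → Fin H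
  /-- Emission function of the max-player. -/
  x : S → X
  /-- Emission function of the min-player. -/
  y : S → Y
  layerX_x : ∀ s, layerX (x s) = layer s
  layerY_y : ∀ s, layerY (y s) = layer s
  /-- Law of the initial state. -/
  init : PMF S
  /-- Transition kernel; its value at states of the last layer plays no role. -/
  trans : S → A → B → PMF S
  layer_init : ∀ s ∈ init.support, (layer s : ℕ) = 0
  layer_trans : ∀ s a b, (layer s : ℕ) + 1 < H →
    ∀ s' ∈ (trans s a b).support, (layer s' : ℕ) = (layer s : ℕ) + 1

namespace GameForm

variable {H : ℕ} {S X Y A B : Type}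

/-- `F.LeadsTo l s`: the history `l = [(s₁, a₁, b₁), …, (sₖ, aₖ, bₖ)]` of states and actions is
possible, and can be followed by the state `s`. -/
inductive LeadsTo (F : GameForm H S X Y A B) : List (S × A × B) → S → Prop
  | start (s : S) (hs : s ∈ F.init.support) : LeadsTo F [] s
  | next (l : List (S × A × B)) (s : S) (a : A) (b : B) (s' : S) (h : LeadsTo F l s)
      (hl : (F.layer s : ℕ) + 1 < H) (hs' : s' ∈ (F.trans s a b).support) :
      LeadsTo F (l ++ [(s, a, b)]) s'

/-- Tree structure: exactly one history leads to each state. -/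
def TreeStructure (F : GameForm H S X Y A B) : Prop :=
  ∀ s, ∃! l : List (S × A × B), F.LeadsTo l s

/-- Perfect recall of the max-player: exactly one history of her own infosets and actions leads
to each of her infosets. -/
def PerfectRecallMax (F : GameForm H S X Y A B) : Prop :=
  ∀ i : X, ∃! l : List (X × A), ∃ (k : List (S × A × B)) (s : S),
    F.LeadsTo k s ∧ F.x s = i ∧ k.map (fun q => (F.x q.1, q.2.1)) = l

/-- Perfect recall of the min-player. -/
def PerfectRecallMin (F : GameForm H S X Y A B) : Prop :=
  ∀ i : Y, ∃! l : List (Y × B), ∃ (k : List (S × A × B)) (s : S),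
    F.LeadsTo k s ∧ F.y s = i ∧ k.map (fun q => (F.y q.1, q.2.2)) = l

/-- The game form of an imperfect-information extensive-form game: a partially observable Markov
game with tree structure in which both players have perfect recall. -/
structure IsIIEFG (F : GameForm H S X Y A B) : Prop where
  tree : F.TreeStructure
  recallMax : F.PerfectRecallMax
  recallMin : F.PerfectRecallMin

end GameForm

/-- The rewards of a game: for every state and pair of actions, the law of a random reward
in `[0, 1]`. -/
abbrev Rewards (S A B : Type) : Type := S → A → B → PMF unitInterval

/-- A two-player zero-sum partially observable Markov game. -/
structure Game (H : ℕ) (S X Y A B : Type) extends GameForm H S X Y A B where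
  reward : Rewards S A B

/-- What happens in one episode: the sequence of the `(s_h, a_h, b_h, r_h)`. -/
abbrev Trajectory (S A B : Type) : Type := List (S × A × B × unitInterval)

/-- What the max-player observes of an episode: the sequence of the `(x_h, a_h, r_h)`. -/
abbrev MaxObs (X A : Type) : Type := List (X × A × unitInterval)

/-- What the two players together observe of an episode: the sequence of the
`(x_h, y_h, a_h, b_h, r_h)`. -/
abbrev JointObs (X Y A B : Type) : Type := List (X × Y × A × B × unitInterval)

namespace Game

variable {H : ℕ} {S X Y A B : Type}

/-- The law of the next `n` steps from the state `s` on, if the players use `μ` and `ν`. -/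
def runFrom (G : Game H S X Y A B) (μ : Policy X A) (ν : Policy Y B) :
    ℕ → S → PMF (Trajectory S A B)
  | 0, _ => PMF.pure []
  | n + 1, s =>
    (μ (G.x s)).bind fun a => (ν (G.y s)).bind fun b => (G.reward s a b).bind fun r =>
      (G.trans s a b).bind fun s' =>
        (runFrom G μ ν n s').map fun τ => (s, a, b, r) :: τ

/-- The law of an episode (`H` steps) if the players use `μ` and `ν`. -/
def episode (G : Game H S X Y A B) (μ : Policy X A) (ν : Policy Y B) :
    PMF (Trajectory S A B) :=
  G.init.bind fun s => G.runFrom μ ν H s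

/-- The value `V^{μ,ν}`: the expected total reward of an episode. -/
def value (G : Game H S X Y A B) (μ : Policy X A) (ν : Policy Y B) : ℝ :=
  (G.episode μ ν).expect fun τ => (τ.map fun q => (q.2.2.2 : ℝ)).sum

/-- The Nash equilibrium gap of `(μ, ν)`. -/
def neGap (G : Game H S X Y A B) (μ : Policy X A) (ν : Policy Y B) : ℝ :=
  (⨆ μ' : Policy X A, G.value μ' ν) - ⨅ ν' : Policy Y B, G.value μ ν'

/-- The max-player's observation of an episode. -/
def maxObs (G : Game H S X Y A B) (τ : Trajectory S A B) : MaxObs X A :=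
  τ.map fun q => (G.x q.1, q.2.1, q.2.2.2)

/-- The joint observation of an episode by the two players. -/
def jointObs (G : Game H S X Y A B) (τ : Trajectory S A B) : JointObs X Y A B :=
  τ.map fun q => (G.x q.1, G.y q.1, q.2.1, q.2.2.1, q.2.2.2)

/-- The law of the first `T` episodes, in order, if the policies used in each episode are
determined by the previous episodes through `σ`. -/
def play (G : Game H S X Y A B) (σ : List (Trajectory S A B) → Policy X A × Policy Y B) :
    ℕ → PMF (List (Trajectory S A B))
  | 0 => PMF.pure []
  | T + 1 => (play G σ T).bind fun past =>
      (G.episode (σ past).1 (σ past).2).map fun τ => past ++ [τ]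

/-- The regret of the max-player over `T` episodes: with `(μ^t, ν^t)` the policies that `σ`
chose for episode `t`, this is `max_{μ'} ∑_t (V^{μ',ν^t} - V^{μ^t,ν^t})`. -/
def regret (G : Game H S X Y A B) (σ : List (Trajectory S A B) → Policy X A × Policy Y B)
    (T : ℕ) (past : List (Trajectory S A B)) : ℝ :=
  ⨆ μ' : Policy X A, ∑ t ∈ Finset.range T,
    (G.value μ' (σ (past.take t)).2 - G.value (σ (past.take t)).1 (σ (past.take t)).2)

end Game

/-- A (possibly randomized) algorithm for the max-player. `Ω` carries its internal randomness; the
policy for the next episode is determined by the outcome `ω` and the player's observations of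
the episodes so far. -/
structure MaxAlgorithm (Ω : Type) [MeasurableSpace Ω] (X A : Type) where
  policy : Ω → List (MaxObs X A) → Policy X A
  measurable_policy : ∀ o i a, Measurable fun ω => policy ω o i a

/-- A (possibly randomized) algorithm that controls both players: it chooses the policies for the
next episode, and a final pair of policies, from the joint observations of the episodes so far. -/
structure JointAlgorithm (Ω : Type) [MeasurableSpace Ω] (X Y A B : Type) where
  policyMax : Ω → List (JointObs X Y A B) → Policy X A
  policyMin : Ω → List (JointObs X Y A B) → Policy Y B
  outputMax : Ω → List (JointObs X Y A B) → Policy X A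
  outputMin : Ω → List (JointObs X Y A B) → Policy Y B
  measurable_policyMax : ∀ o i a, Measurable fun ω => policyMax ω o i a
  measurable_policyMin : ∀ o i b, Measurable fun ω => policyMin ω o i b
  measurable_outputMax : ∀ o i a, Measurable fun ω => outputMax ω o i a
  measurable_outputMin : ∀ o i b, Measurable fun ω => outputMin ω o i b

namespace Game

variable {H : ℕ} {S X Y A B : Type} {Ω : Type} [MeasurableSpace Ω]

/-- The expected regret over `T` episodes of a max-player who follows `alg`. The min-player's
policy in each episode is chosen by `opp`, which sees all the past and the internal randomness
of `alg` (hence also the max-player's current policy). -/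
def expectedRegret (G : Game H S X Y A B) (P : MeasureTheory.Measure Ω)
    (alg : MaxAlgorithm Ω X A) (opp : Ω → List (Trajectory S A B) → Policy Y B) (T : ℕ) : ℝ :=
  ∫ ω, (G.play (fun past => (alg.policy ω (past.map G.maxObs), opp ω past)) T).expect
    (G.regret (fun past => (alg.policy ω (past.map G.maxObs), opp ω past)) T) ∂P

/-- The expected Nash equilibrium gap of the output of `alg` after `T` episodes. -/
def expectedNEGap (G : Game H S X Y A B) (P : MeasureTheory.Measure Ω)
    (alg : JointAlgorithm Ω X Y A B) (T : ℕ) : ℝ :=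
  ∫ ω, (G.play (fun past => (alg.policyMax ω (past.map G.jointObs),
      alg.policyMin ω (past.map G.jointObs))) T).expect
    (fun past => G.neGap (alg.outputMax ω (past.map G.jointObs))
      (alg.outputMin ω (past.map G.jointObs))) ∂P

end Game

end

/-! The hard games hide a bandit with exponentially many arms. Both players move for `H` steps and
see only their own actions, so the infosets of a player form a complete tree. All rewards vanish
except a coin tossed after the last step, whose mean is shifted by `δ` if one player's action
sequence is a secret `i`. An episode is thus one pull of a bandit with `K = A ^ H` (or `B ^ H`)
arms, and `K` agrees with `X * A` up to a factor 2. The other player has no influence, so regret and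
gap equal `δ` times the (summed) probability of not playing `i` (`regret_of_armMean`,
`neGap_of_armMean_fst`, `neGap_of_armMean_snd`).

The bandit bound compares each bandit with the one in which no arm is special. There, the
probabilities that the output is `i` sum to 1 over `i`. Passing to the bandit with special arm `i`
costs at most `η` plus a multiple of the relative entropy. One pull is informative about a single
`i` only, so these entropies sum over `i` to `O(δ ^ 2 * T)`, and not `K` times as much
(`sum_adaptiveExpect_le`, `sum_adaptiveExpect_bandit_le`). If `δ ^ 2 * T` is a small multiple of
`K`, the average over `i` of the probability of success stays below a constant less than 1.
Averaging over the algorithm's randomness as well yields one bad `i` (`exists_arm_integral_ge`).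
Regret takes `δ` of order `√(K / T)`, the gap takes `δ` of order `ε`. -/

noncomputable section

open Finset MeasureTheory

/-! ### Adaptive sampling and change of measure -/

/-- The expectation of `f` over `T` adaptive samples, the next of which has the law `κ past`. -/
def adaptiveExpect {E : Type} [Fintype E] (κ : List E → E → ℝ) : ℕ → (List E → ℝ) → ℝ
  | 0, f => f []
  | T + 1, f => adaptiveExpect κ T fun past => ∑ e, κ past e * f (past ++ [e])

section AdaptiveExpect

variable {E : Type} [Fintype E] {κ : List E → E → ℝ}

theorem adaptiveExpect_add (T : ℕ) (f g : List E → ℝ) :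
    adaptiveExpect κ T (fun l => f l + g l) = adaptiveExpect κ T f + adaptiveExpect κ T g := by
  induction T generalizing f g with
  | zero => rfl
  | succ T ih => simp only [adaptiveExpect, mul_add, sum_add_distrib, ih]

theorem adaptiveExpect_const_mul (T : ℕ) (a : ℝ) (f : List E → ℝ) :
    adaptiveExpect κ T (fun l => a * f l) = a * adaptiveExpect κ T f := by
  induction T generalizing f with
  | zero => rfl
  | succ T ih =>
    simp only [adaptiveExpect, ← ih, mul_sum]
    simp only [mul_left_comm]

theorem adaptiveExpect_const (hκ : ∀ l, ∑ e, κ l e = 1) (T : ℕ) (a : ℝ) :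
    adaptiveExpect κ T (fun _ => a) = a := by
  induction T with
  | zero => rfl
  | succ T ih => simp only [adaptiveExpect, ← sum_mul, hκ, one_mul, ih]

theorem adaptiveExpect_sum {ι : Type} (s : Finset ι) (T : ℕ) (f : ι → List E → ℝ) :
    adaptiveExpect κ T (fun l => ∑ i ∈ s, f i l) = ∑ i ∈ s, adaptiveExpect κ T (f i) := by
  induction T generalizing f with
  | zero => rfl
  | succ T ih =>
    simp only [adaptiveExpect, ← ih, mul_sum]
    congr 1; funext l
    exact sum_comm

theorem adaptiveExpect_mono (hκ : ∀ l e, 0 ≤ κ l e) (T : ℕ) {f g : List E → ℝ}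
    (h : ∀ l, f l ≤ g l) : adaptiveExpect κ T f ≤ adaptiveExpect κ T g := by
  induction T generalizing f g with
  | zero => exact h _
  | succ T ih => exact ih fun l => sum_le_sum fun e _ => mul_le_mul_of_nonneg_left (h _) (hκ l e)

/-- Change of measure. -/
theorem adaptiveExpect_mul_right (w : E → ℝ) (T : ℕ) (f : List E → ℝ) :
    adaptiveExpect (fun l e => κ l e * w e) T f =
      adaptiveExpect κ T fun l => (l.map w).prod * f l := by
  induction T generalizing f with
  | zero => simp [adaptiveExpect]
  | succ T ih =>
    simp only [adaptiveExpect, ih, mul_sum]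
    congr 1; funext l
    refine sum_congr rfl fun e _ => ?_
    simp only [List.map_append, List.map_cons, List.map_nil, List.prod_append, List.prod_cons,
      List.prod_nil]
    ring

theorem measurable_adaptiveExpect {Ω : Type} [MeasurableSpace Ω] {κ : Ω → List E → E → ℝ}
    {f : Ω → List E → ℝ} (hκ : ∀ l e, Measurable fun ω => κ ω l e)
    (hf : ∀ l, Measurable fun ω => f ω l) (T : ℕ) :
    Measurable fun ω => adaptiveExpect (κ ω) T (f ω) := by
  induction T generalizing f with
  | zero => exact hf _
  | succ T ih =>
    exact ih fun l => Finset.measurable_fun_sum _ fun e _ => (hκ l e).mul (hf _)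

/-- The tangent to `log` at `1 + η`, with `log (1 + η) ≤ η`. Applied to a likelihood ratio of mean
one, the last bracket has the relative entropy as its mean. The bound is linear in the entropy, so
it can be summed over the arms without Pinsker's inequality. -/
theorem sub_one_le_add_sub_log {x η : ℝ} (hx : 0 < x) (hη : 0 < η) :
    x - 1 ≤ η + (1 + η) / η * (x - 1 - Real.log x) := by
  have h1 : Real.log (x / (1 + η)) ≤ x / (1 + η) - 1 := Real.log_le_sub_one_of_pos (by positivity)
  rw [Real.log_div hx.ne' (by positivity)] at h1
  have h2 : Real.log (1 + η) ≤ 1 + η - 1 := Real.log_le_sub_one_of_pos (by positivity)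
  have h3 : x - 1 - x / (1 + η) + 1 - η ≤ x - 1 - Real.log x := by linarith
  calc x - 1 = η + (1 + η) / η * (x - 1 - x / (1 + η) + 1 - η) := by field_simp; ring
    _ ≤ _ := by gcongr

/-- If `κ` is perturbed by a likelihood ratio `w i`, for `i` in a finite set, then `κ` and the
perturbed kernels are on average hard to tell apart when the relative entropies are small. -/
theorem sum_adaptiveExpect_le {ι : Type} [Fintype ι] (hκ : ∀ l e, 0 ≤ κ l e)
    (hκ1 : ∀ l, ∑ e, κ l e = 1) (w : ι → E → ℝ) (hw : ∀ i e, 0 < w i e)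
    (hw1 : ∀ i l, ∑ e, κ l e * w i e = 1) {D : ℝ}
    (hD : ∀ l, ∑ e, κ l e * ∑ i, -Real.log (w i e) ≤ D) (f : ι → List E → ℝ)
    (hf0 : ∀ i l, 0 ≤ f i l) (hf : ∀ l, ∑ i, f i l = 1) {η : ℝ} (hη : 0 < η) (T : ℕ) :
    ∑ i, adaptiveExpect (fun l e => κ l e * w i e) T (f i) ≤
      1 + Fintype.card ι * η + (1 + η) / η * (D * T) := by
  set L : ι → List E → ℝ := fun i l => (l.map (w i)).prod with hL
  have hLpos : ∀ i l, 0 < L i l := fun i l => by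
    refine List.prod_pos fun a ha => ?_
    obtain ⟨e, -, rfl⟩ := List.mem_map.1 ha
    exact hw i e
  have hf1 : ∀ i l, f i l ≤ 1 := fun i l =>
    (hf l) ▸ single_le_sum (fun j _ => hf0 j l) (mem_univ i)
  -- Chain rule: each new sample adds at most `D` to the sum of the relative entropies.
  have hlog : adaptiveExpect κ T (fun l => ∑ i, -Real.log (L i l)) ≤ D * T := by
    clear hf hf1
    induction T with
    | zero => simp [adaptiveExpect, hL]
    | succ T ih =>
      calc _ ≤ adaptiveExpect κ T (fun l => (∑ i, -Real.log (L i l)) + D) := by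
            refine adaptiveExpect_mono hκ T fun l => ?_
            have : ∀ e i, -Real.log (L i (l ++ [e])) =
                -Real.log (L i l) + -Real.log (w i e) := fun e i => by
              have : L i (l ++ [e]) = L i l * w i e := by simp [hL]
              rw [this, Real.log_mul (hLpos i l).ne' (hw i e).ne']; ring
            simp only [this, sum_add_distrib, mul_add, ← sum_mul, hκ1, one_mul]
            linarith [hD l]
        _ ≤ _ := by
            rw [adaptiveExpect_add, adaptiveExpect_const hκ1]
            push_cast; linarith
  have hL1 : ∀ i, adaptiveExpect κ T (L i) = 1 := fun i => by
    have := adaptiveExpect_mul_right (κ := κ) (w i) T fun _ => 1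
    simpa [adaptiveExpect_const (hw1 i), hL] using this.symm
  -- Since `0 ≤ f ≤ 1`, `L * f` exceeds `f` by at most any nonnegative upper bound of `L - 1`.
  have hpt : ∀ i, adaptiveExpect (fun l e => κ l e * w i e) T (f i) ≤
      adaptiveExpect κ T (f i) + η +
        (1 + η) / η * adaptiveExpect κ T (fun l => -Real.log (L i l)) := fun i => by
    rw [adaptiveExpect_mul_right]
    calc _ ≤ adaptiveExpect κ T (fun l => f i l +
            (η + (1 + η) / η * (L i l + (-1 + -Real.log (L i l))))) := by
          refine adaptiveExpect_mono hκ T fun l => ?_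
          have h1 := sub_one_le_add_sub_log (hLpos i l) hη
          have h2 := Real.log_le_sub_one_of_pos (hLpos i l)
          have h3 : 0 ≤ η + (1 + η) / η * (L i l + (-1 + -Real.log (L i l))) := by
            have : 0 ≤ L i l + (-1 + -Real.log (L i l)) := by linarith
            positivity
          have h4 : L i l - 1 ≤ η + (1 + η) / η * (L i l + (-1 + -Real.log (L i l))) := by
            convert h1 using 3; ring
          change L i l * f i l ≤ _
          nlinarith [hf0 i l, hf1 i l]
      _ = _ := by
          rw [adaptiveExpect_add, adaptiveExpect_add, adaptiveExpect_const hκ1,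
            adaptiveExpect_const_mul, adaptiveExpect_add, adaptiveExpect_add, hL1,
            adaptiveExpect_const hκ1]
          ring
  calc _ ≤ ∑ i, (adaptiveExpect κ T (f i) + η +
        (1 + η) / η * adaptiveExpect κ T (fun l => -Real.log (L i l))) :=
        sum_le_sum fun i _ => hpt i
    _ = 1 + Fintype.card ι * η +
        (1 + η) / η * adaptiveExpect κ T (fun l => ∑ i, -Real.log (L i l)) := by
        rw [sum_add_distrib, sum_add_distrib, ← mul_sum, ← adaptiveExpect_sum,
          ← adaptiveExpect_sum]
        simp only [hf, adaptiveExpect_const hκ1]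
        simp
    _ ≤ _ := by gcongr

end AdaptiveExpect

/-! ### Coin bandits with one special arm -/

/-- The probabilities of the two outcomes of a coin of mean `t`. -/
def coinProb (t : ℝ) (b : Bool) : ℝ := if b then t else 1 - t

theorem coinProb_nonneg {t : ℝ} (h0 : 0 ≤ t) (h1 : t ≤ 1) (b : Bool) : 0 ≤ coinProb t b := by
  cases b <;> simp [coinProb, h0, h1]

theorem coinProb_pos {t : ℝ} (h0 : 0 < t) (h1 : t < 1) (b : Bool) : 0 < coinProb t b := by
  cases b <;> simp [coinProb, h0, h1]

theorem sum_coinProb (t : ℝ) : ∑ b, coinProb t b = 1 := by simp [coinProb]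

/-- The mean of the coin of arm `j`, in the bandit whose special arm is `i`. -/
def armMean {ι : Type} [DecidableEq ι] (δ : ℝ) (i j : ι) : ℝ :=
  if j = i then 1 / 2 + δ / 2 else 1 / 2 - δ / 2

/-- One step of a bandit: a path `v` is chosen with law `m past`, then a coin of mean `q v` is
tossed. -/
def banditKernel {V : Type} (m : List (V × Bool) → V → ℝ) (q : V → ℝ) :
    List (V × Bool) → V × Bool → ℝ :=
  fun past e => m past e.1 * coinProb (q e.1) e.2

theorem sum_banditKernel {V : Type} [Fintype V] {m : List (V × Bool) → V → ℝ} (hm1 : ∀ l, ∑ v, m l v = 1) (q : V → ℝ)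
    (l : List (V × Bool)) : ∑ e, banditKernel m q l e = 1 := by
  simp only [banditKernel, Fintype.sum_prod_type, ← mul_sum, sum_coinProb, mul_one, hm1]

/-- Relative entropy is at most the chi-square divergence, here `4 * δ ^ 2 / (1 - δ ^ 2)`. For `|δ|
≤ 3 / 4` the denominator is at least `7 / 16`, and `64 / 7 ≤ 10`. The sign of `δ` is free because
the min-player's special arm has the lower mean. -/
theorem neg_log_coin_le {δ : ℝ} (hδ : |δ| ≤ 3 / 4) :
    ∑ b, coinProb (1 / 2 - δ / 2) b *
      -Real.log (coinProb (1 / 2 + δ / 2) b / coinProb (1 / 2 - δ / 2) b) ≤ 10 * δ ^ 2 := by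
  obtain ⟨h1, h2⟩ := abs_le.1 hδ
  have hp : ∀ b, 0 < coinProb (1 / 2 - δ / 2) b := coinProb_pos (by linarith) (by linarith)
  have hq : ∀ b, 0 < coinProb (1 / 2 + δ / 2) b := coinProb_pos (by linarith) (by linarith)
  have key : ∀ b, coinProb (1 / 2 - δ / 2) b *
      -Real.log (coinProb (1 / 2 + δ / 2) b / coinProb (1 / 2 - δ / 2) b) ≤
      coinProb (1 / 2 - δ / 2) b *
        (coinProb (1 / 2 - δ / 2) b / coinProb (1 / 2 + δ / 2) b - 1) := fun b => by
    refine mul_le_mul_of_nonneg_left ?_ (hp b).le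
    rw [← Real.log_inv, inv_div]
    exact Real.log_le_sub_one_of_pos (div_pos (hp b) (hq b))
  refine (sum_le_sum fun b _ => key b).trans ?_
  simp only [Fintype.sum_bool, coinProb, if_true, Bool.false_eq_true, if_false]
  have e : (1 / 2 - δ / 2) * ((1 / 2 - δ / 2) / (1 / 2 + δ / 2) - 1) +
      (1 - (1 / 2 - δ / 2)) * ((1 - (1 / 2 - δ / 2)) / (1 - (1 / 2 + δ / 2)) - 1) =
      4 * δ ^ 2 / (1 - δ ^ 2) := by
    have a1 : (1 + δ) ≠ 0 := by linarith
    have a2 : (1 - δ) ≠ 0 := by linarith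
    have a3 : 1 - δ ^ 2 ≠ 0 := by
      have : 1 - δ ^ 2 = (1 + δ) * (1 - δ) := by ring
      rw [this]; exact mul_ne_zero a1 a2
    have e1 : 1 / 2 + δ / 2 = (1 + δ) / 2 := by ring
    have e2 : 1 / 2 - δ / 2 = (1 - δ) / 2 := by ring
    have e3 : 1 - (1 - δ) / 2 = (1 + δ) / 2 := by ring
    have e4 : 1 - (1 + δ) / 2 = (1 - δ) / 2 := by ring
    rw [e1, e2, e3, e4]
    field_simp
    ring
  rw [e]
  have hd : δ ^ 2 ≤ 9 / 16 := by nlinarith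
  rw [div_le_iff₀ (by linarith)]
  nlinarith [sq_nonneg δ]

/-- In a bandit with a special arm that is unknown, any `[0, 1]`-valued statistics `f i` of total
mass one are on average small. -/
theorem sum_adaptiveExpect_bandit_le {V ι : Type} [Fintype V] [Fintype ι] [DecidableEq ι]
    (arm : V → ι) (m : List (V × Bool) → V → ℝ) (hm : ∀ l v, 0 ≤ m l v)
    (hm1 : ∀ l, ∑ v, m l v = 1) {δ : ℝ} (hδ : |δ| ≤ 3 / 4) (f : ι → List (V × Bool) → ℝ)
    (hf0 : ∀ i l, 0 ≤ f i l) (hf : ∀ l, ∑ i, f i l = 1) (T : ℕ) :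
    ∑ i, adaptiveExpect (banditKernel m fun v => armMean δ i (arm v)) T (f i) ≤
      1 + Fintype.card ι / 12 + 130 * δ ^ 2 * T := by
  obtain ⟨h1, h2⟩ := abs_le.1 hδ
  have hp : ∀ b, 0 < coinProb (1 / 2 - δ / 2) b := coinProb_pos (by linarith) (by linarith)
  have hq : ∀ b, 0 < coinProb (1 / 2 + δ / 2) b := coinProb_pos (by linarith) (by linarith)
  -- The ratio differs from 1 only when arm `i` is pulled, so at each pull the sum over `i` of the
  -- logarithms has a single term.
  set w : ι → V × Bool → ℝ := fun i e =>
    if arm e.1 = i then coinProb (1 / 2 + δ / 2) e.2 / coinProb (1 / 2 - δ / 2) e.2 else 1 with hw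
  have hmul : ∀ i, (banditKernel m fun v => armMean δ i (arm v)) =
      fun l e => banditKernel m (fun _ => 1 / 2 - δ / 2) l e * w i e := fun i => by
    funext l e
    simp only [banditKernel, armMean, hw]
    split_ifs
    · rw [mul_assoc, mul_div_cancel₀ _ (hp _).ne']
    · rw [mul_one]
  have hsum := sum_banditKernel hm1
  simp only [hmul]
  -- With `η = 1 / 12` the factor `(1 + η) / η` is 13, whence `130 = 13 * 10`.
  refine (sum_adaptiveExpect_le (D := 10 * δ ^ 2) (η := 1 / 12) ?_ (hsum _) w ?_ ?_ ?_ f hf0 hf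
    (by norm_num) T).trans (le_of_eq (by ring))
  · exact fun l e => mul_nonneg (hm _ _) (hp _).le
  · intro i e
    simp only [hw]
    split_ifs
    exacts [div_pos (hq _) (hp _), one_pos]
  · intro i l
    exact (sum_congr rfl fun e _ => congrFun (congrFun (hmul i) l) e).symm.trans (hsum _ l)
  · intro l
    have : ∀ e : V × Bool, ∑ i, -Real.log (w i e) =
        -Real.log (coinProb (1 / 2 + δ / 2) e.2 / coinProb (1 / 2 - δ / 2) e.2) := fun e => by
      rw [sum_eq_single (arm e.1)]
      · simp [hw]
      · intro i _ hi
        simp [hw, hi.symm]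
      · simp
    simp only [this, banditKernel, Fintype.sum_prod_type, mul_assoc, ← mul_sum]
    rw [← sum_mul, hm1, one_mul]
    exact neg_log_coin_le hδ

/-! ### Expectations under finitely supported laws -/

namespace PMF

variable {α β : Type}

/-- Trajectories carry rewards in `[0, 1]`, so their type is infinite. The laws that occur have
finite support, which removes all questions of summability. -/
theorem expect_eq_sum (p : PMF α) {s : Finset α} (h : p.support ⊆ s) (f : α → ℝ) :
    p.expect f = ∑ a ∈ s, (p a).toReal * f a := by
  refine tsum_eq_sum fun a ha => ?_
  have : p a = 0 := by
    by_contra h0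
    exact ha (h ((p.mem_support_iff a).2 h0))
  simp [this]

theorem expect_eq_sum_univ [Fintype α] (p : PMF α) (f : α → ℝ) :
    p.expect f = ∑ a, (p a).toReal * f a :=
  p.expect_eq_sum (by simp) f

theorem expect_pure (a : α) (f : α → ℝ) : (PMF.pure a).expect f = f a := by
  rw [(PMF.pure a).expect_eq_sum (s := {a}) (by simp)]
  simp

theorem finite_support_bind {p : PMF α} {k : α → PMF β} (hp : p.support.Finite)
    (hk : ∀ a, (k a).support.Finite) : (p.bind k).support.Finite := by
  rw [support_bind]
  exact hp.biUnion fun a _ => hk a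

theorem expect_bind {p : PMF α} {k : α → PMF β} (hp : p.support.Finite)
    (hk : ∀ a, (k a).support.Finite) (f : β → ℝ) :
    (p.bind k).expect f = p.expect fun a => (k a).expect f := by
  have hs := finite_support_bind hp hk
  rw [(p.bind k).expect_eq_sum (s := hs.toFinset) (by simp),
    p.expect_eq_sum (s := hp.toFinset) (by simp)]
  have h1 : ∀ b, ((p.bind k) b).toReal = ∑ a ∈ hp.toFinset, (p a).toReal * (k a b).toReal := by
    intro b
    rw [bind_apply, tsum_eq_sum (s := hp.toFinset),
      ENNReal.toReal_sum fun a _ => ENNReal.mul_ne_top (p.apply_ne_top a) ((k a).apply_ne_top b)]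
    · simp
    · intro a ha
      have : p a = 0 := by simpa using ha
      simp [this]
  simp only [h1, sum_mul]
  rw [sum_comm]
  refine sum_congr rfl fun a ha => ?_
  rw [(k a).expect_eq_sum (s := hs.toFinset), mul_sum]
  · exact sum_congr rfl fun b _ => mul_assoc _ _ _
  · intro b hb
    simp only [Set.Finite.coe_toFinset, support_bind]
    exact Set.mem_biUnion (by simpa using ha) hb

theorem finite_support_map {p : PMF α} (hp : p.support.Finite) (g : α → β) :
    (p.map g).support.Finite := by
  rw [support_map]; exact hp.image g

theorem expect_map {p : PMF α} (hp : p.support.Finite) (g : α → β) (f : β → ℝ) :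
    (p.map g).expect f = p.expect (f ∘ g) := by
  rw [← bind_pure_comp, expect_bind hp fun a => by simp]
  simp [expect_pure, Function.comp_def]

theorem sum_toReal [Fintype α] (p : PMF α) : ∑ a, (p a).toReal = 1 := by
  rw [← ENNReal.toReal_sum fun a _ => p.apply_ne_top a, ← tsum_fintype (L := .unconditional α),
    p.tsum_coe, ENNReal.toReal_one]

theorem toReal_map [Fintype α] [DecidableEq β] (p : PMF α) (g : α → β) (b : β) :
    ((p.map g) b).toReal = ∑ a, if g a = b then (p a).toReal else 0 := by
  rw [map_apply, tsum_fintype, ENNReal.toReal_sum]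
  · refine sum_congr rfl fun a _ => ?_
    simp only [eq_comm (a := b)]
    split_ifs <;> simp
  · intro a _
    split_ifs <;> simp [p.apply_ne_top]

/-- The law of a coin of mean `t`. -/
def coin (t : unitInterval) : PMF Bool :=
  PMF.ofFintype (fun b => ENNReal.ofReal (coinProb t b)) <| by
    rw [← ENNReal.ofReal_sum_of_nonneg fun b _ => coinProb_nonneg t.2.1 t.2.2 b, sum_coinProb,
      ENNReal.ofReal_one]

theorem coin_toReal (t : unitInterval) (b : Bool) : (coin t b).toReal = coinProb t b := by
  rw [coin, ofFintype_apply, ENNReal.toReal_ofReal (coinProb_nonneg t.2.1 t.2.2 b)]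

/-- Makes the opponent unique when the min-player has one action. -/
instance [Subsingleton α] : Subsingleton (PMF α) :=
  ⟨fun p q => PMF.ext fun a => by
    have h : ∀ p : PMF α, p a = 1 := fun p => by
      rw [apply_eq_one_iff]
      exact Set.eq_singleton_iff_unique_mem.2
        ⟨p.support_nonempty.elim fun b hb => Subsingleton.elim b a ▸ hb,
          fun b _ => Subsingleton.elim b a⟩
    rw [h, h]⟩

end PMF

/-! ### Action trees and the simultaneous-move game form -/

/-- The decision points of a sequence of at most `H` actions. -/
abbrev ActionNode (C : Type) (H : ℕ) : Type := {l : List C // l.length < H}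

namespace ActionNode

variable {C D : Type} {H : ℕ}

/-- Nodes as a step together with the sequence of the earlier actions. -/
def equivSigma (C : Type) (H : ℕ) : ActionNode C H ≃ Σ h : Fin H, List.Vector C h where
  toFun l := ⟨⟨l.1.length, l.2⟩, ⟨l.1, rfl⟩⟩
  invFun v := ⟨v.2.1, by rw [v.2.2]; exact v.1.2⟩
  left_inv _ := rfl
  right_inv := by
    rintro ⟨⟨h, _⟩, ⟨l, hl⟩⟩
    obtain rfl : l.length = h := hl
    rfl

instance [Fintype C] : Fintype (ActionNode C H) := Fintype.ofEquiv _ (equivSigma C H).symm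

theorem card_eq [Fintype C] :
    Fintype.card (ActionNode C H) = ∑ h ∈ range H, Fintype.card C ^ h := by
  rw [Fintype.card_congr (equivSigma C H), Fintype.card_sigma]
  simp only [card_vector]
  exact Fin.sum_univ_eq_sum_range (fun h => Fintype.card C ^ h) H

/-- Apply a function to all actions. -/
def map (π : C → D) (s : ActionNode C H) : ActionNode D H :=
  ⟨s.1.map π, by simpa using s.2⟩

/-- The root. -/
def root (hH : 0 < H) : ActionNode C H := ⟨[], hH⟩

/-- The node after the action `c`; the last nodes have no successor, and are fixed. -/
def next (s : ActionNode C H) (c : C) : ActionNode C H :=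
  if h : s.1.length + 1 < H then ⟨s.1 ++ [c], by simpa using h⟩ else s

theorem next_val {s : ActionNode C H} (h : s.1.length + 1 < H) (c : C) :
    (s.next c).1 = s.1 ++ [c] := by simp [next, h]

theorem map_next (π : C → D) (s : ActionNode C H) (c : C) :
    (s.next c).map π = (s.map π).next (π c) := by
  by_cases h : s.1.length + 1 < H <;> simp [next, map, h]

end ActionNode

/-- The game form in which the two players move simultaneously for `H` steps, and each observes
only her own actions. -/
def simultaneousForm {H : ℕ} (hH : 0 < H) (A B : Type) :
    GameForm H (ActionNode (A × B) H) (ActionNode A H) (ActionNode B H) A B where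
  layer s := ⟨s.1.length, s.2⟩
  layerX s := ⟨s.1.length, s.2⟩
  layerY s := ⟨s.1.length, s.2⟩
  x := ActionNode.map Prod.fst
  y := ActionNode.map Prod.snd
  layerX_x s := by simp [ActionNode.map]
  layerY_y s := by simp [ActionNode.map]
  init := PMF.pure (ActionNode.root hH)
  trans s a b := PMF.pure (s.next (a, b))
  layer_init s hs := by
    rw [PMF.support_pure, Set.mem_singleton_iff] at hs
    simp [hs, ActionNode.root]
  layer_trans s a b h s' hs' := by
    rw [PMF.support_pure, Set.mem_singleton_iff] at hs'
    simp [hs', ActionNode.next_val h]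

section SimultaneousForm

variable {H : ℕ} {hH : 0 < H} {A B : Type}

theorem simultaneousForm_leadsTo_cases {k : List (ActionNode (A × B) H × A × B)}
    {s : ActionNode (A × B) H} (h : (simultaneousForm hH A B).LeadsTo k s) :
    (k = [] ∧ s.1 = []) ∨ ∃ l s₀ a b, (simultaneousForm hH A B).LeadsTo l s₀ ∧
      k = l ++ [(s₀, a, b)] ∧ s.1 = s₀.1 ++ [(a, b)] := by
  cases h with
  | start s hs =>
    rw [simultaneousForm, PMF.support_pure, Set.mem_singleton_iff] at hs
    exact .inl ⟨rfl, by rw [hs]; rfl⟩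
  | next l s₀ a b s' h₀ hl hs' =>
    rw [simultaneousForm, PMF.support_pure, Set.mem_singleton_iff] at hs'
    exact .inr ⟨l, s₀, a, b, h₀, rfl, by rw [hs', ActionNode.next_val hl]⟩

/-- A node records the whole action sequence, so its predecessor and last action can be read off,
also after projecting by `π`. The case `π = id` gives tree structure, the two coordinate projections
give perfect recall. -/
theorem simultaneousForm_history_unique {C : Type} (π : A × B → C) (n : ℕ) :
    ∀ {k k' : List (ActionNode (A × B) H × A × B)} {s s' : ActionNode (A × B) H},
    s.1.length = n → (simultaneousForm hH A B).LeadsTo k s →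
    (simultaneousForm hH A B).LeadsTo k' s' → s.map π = s'.map π →
    k.map (fun q => (q.1.map π, π q.2)) = k'.map (fun q => (q.1.map π, π q.2)) := by
  induction n with
  | zero =>
    intro k k' s s' hn h h' hs
    have hs := congrArg Subtype.val hs
    have hlen := congrArg List.length hs
    simp only [ActionNode.map, List.length_map] at hs hlen
    rcases simultaneousForm_leadsTo_cases h with ⟨rfl, h1⟩ | ⟨l, s₀, a, b, h0, rfl, h1⟩ <;>
    rcases simultaneousForm_leadsTo_cases h' with ⟨rfl, h1'⟩ | ⟨l', s₀', a', b', h0', rfl, h1'⟩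
    · rfl
    all_goals simp_all
  | succ n ih =>
    intro k k' s s' hn h h' hs
    have hs := congrArg Subtype.val hs
    have hlen := congrArg List.length hs
    simp only [ActionNode.map, List.length_map] at hs hlen
    rcases simultaneousForm_leadsTo_cases h with ⟨rfl, h1⟩ | ⟨l, s₀, a, b, h0, rfl, h1⟩
    · simp_all
    rcases simultaneousForm_leadsTo_cases h' with ⟨rfl, h1'⟩ | ⟨l', s₀', a', b', h0', rfl, h1'⟩
    · simp_all
    rw [h1, h1', List.map_append, List.map_append] at hs
    obtain ⟨e1, e2⟩ := List.append_inj' hs rfl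
    have e1 : s₀.map π = s₀'.map π := Subtype.ext e1
    have := ih (by simpa [h1] using hn) h0 h0' e1
    simp only [List.map_append, this, List.map_cons, List.map_nil, e1]
    simpa using e2

theorem simultaneousForm_exists_leadsTo (s : ActionNode (A × B) H) :
    ∃ k, (simultaneousForm hH A B).LeadsTo k s := by
  obtain ⟨l, hl⟩ := s
  induction l using List.reverseRecOn with
  | nil => exact ⟨[], .start _ (by simp [simultaneousForm, ActionNode.root])⟩
  | append_singleton l c ih =>
    have hl' : l.length + 1 < H := by simpa using hl
    obtain ⟨k, hk⟩ := ih (by omega)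
    refine ⟨_, .next k _ c.1 c.2 _ hk hl' ?_⟩
    simp [simultaneousForm, ActionNode.next, hl']

theorem simultaneousForm_isIIEFG [Inhabited A] [Inhabited B] :
    (simultaneousForm hH A B).IsIIEFG where
  tree s := by
    obtain ⟨k, hk⟩ := simultaneousForm_exists_leadsTo (hH := hH) s
    refine ⟨k, hk, fun k' hk' => ?_⟩
    simpa [ActionNode.map] using simultaneousForm_history_unique id _ rfl hk' hk rfl
  recallMax i := by
    -- Any state in the infoset will do; the opponent's actions are filled in by `default`.
    obtain ⟨k, hk⟩ := simultaneousForm_exists_leadsTo (hH := hH) (i.map fun a => (a, (default : B)))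
    refine ⟨_, ⟨k, _, hk, ?_, rfl⟩, ?_⟩
    · simp [simultaneousForm, ActionNode.map, Function.comp_def]
    · rintro l ⟨k', s, hk', hs, rfl⟩
      refine simultaneousForm_history_unique Prod.fst _ rfl hk' hk ?_
      change s.map Prod.fst = i at hs
      rw [hs]
      simp [ActionNode.map, Function.comp_def]
  recallMin i := by
    obtain ⟨k, hk⟩ := simultaneousForm_exists_leadsTo (hH := hH) (i.map fun b => ((default : A), b))
    refine ⟨_, ⟨k, _, hk, ?_, rfl⟩, ?_⟩
    · simp [simultaneousForm, ActionNode.map, Function.comp_def]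
    · rintro l ⟨k', s, hk', hs, rfl⟩
      refine simultaneousForm_history_unique Prod.snd _ rfl hk' hk ?_
      change s.map Prod.snd = i at hs
      rw [hs]
      simp [ActionNode.map, Function.comp_def]

end SimultaneousForm

/-! ### Laws of action sequences -/

section ActionLaw

variable {C D : Type} {H : ℕ}

/-- The law of the next `n` actions of a player who only observes her own actions. -/
def actionLaw (π : Policy (ActionNode C H) C) : (n : ℕ) → ActionNode C H → PMF (List.Vector C n)
  | 0, _ => PMF.pure List.Vector.nil
  | n + 1, s => (π s).bind fun c => (actionLaw π n (s.next c)).map (c ::ᵥ ·)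

/-- With `f` a coordinate projection and `ρ` a joint policy, this says that the law of a player's
actions depends on her own policy only. -/
theorem actionLaw_map {ρ : Policy (ActionNode C H) C} {π : Policy (ActionNode D H) D} {f : C → D}
    (h : ∀ s, (ρ s).map f = π (s.map f)) (n : ℕ) (s : ActionNode C H) :
    (actionLaw ρ n s).map (List.Vector.map f) = actionLaw π n (s.map f) := by
  induction n generalizing s with
  | zero => simp [actionLaw, PMF.pure_map]
  | succ n ih =>
    simp only [actionLaw, PMF.map_bind, ← h, PMF.bind_map]
    congr 1; funext c
    simp only [Function.comp_apply, ← ActionNode.map_next, ← ih, PMF.map_comp]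
    congr 1

theorem exists_actionLaw_eq_pure [Inhabited C] (i : List.Vector C H) (hH : 0 < H) :
    ∃ π : Policy (ActionNode C H) C, actionLaw π H (ActionNode.root hH) = PMF.pure i := by
  refine ⟨fun s => PMF.pure (i.get ⟨s.1.length, s.2⟩), ?_⟩
  -- Generalized to an arbitrary prefix `s` of `i`, with `v` the part still to be played.
  have key : ∀ (n : ℕ) (s : ActionNode C H) (v : List.Vector C n), s.1 ++ v.toList = i.toList →
      actionLaw (fun s => PMF.pure (i.get ⟨s.1.length, s.2⟩)) n s = PMF.pure v := by
    intro n
    induction n with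
    | zero => intro s v _; rw [v.eq_nil]; rfl
    | succ n ih =>
      intro s v hv
      obtain ⟨c, w, rfl⟩ := v.exists_eq_cons
      have hc : i.get ⟨s.1.length, s.2⟩ = c := by
        rw [List.Vector.get_eq_get_toList]
        simp [← hv]
      simp only [actionLaw, PMF.pure_bind, hc]
      by_cases hs : s.1.length + 1 < H
      · rw [ih (s.next c) w (by rw [ActionNode.next_val hs]; simpa using hv), PMF.pure_map]
      -- At a last node `next` does not move, so the induction hypothesis is unavailable; but no
      -- action remains.
      · have hn : n = 0 := by
          have := congrArg List.length hv
          simp at this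
          omega
        subst hn
        rw [w.eq_nil]
        simp [actionLaw, PMF.pure_map]
  exact key H _ i rfl

theorem measurable_actionLaw [Fintype C] {Ω : Type} [MeasurableSpace Ω]
    {π : Ω → Policy (ActionNode C H) C} (h : ∀ s c, Measurable fun ω => π ω s c) (n : ℕ)
    (s : ActionNode C H) (v : List.Vector C n) : Measurable fun ω => actionLaw (π ω) n s v := by
  classical
  induction n generalizing s with
  | zero => exact measurable_const
  | succ n ih =>
    simp only [actionLaw, PMF.bind_apply, PMF.map_apply, tsum_fintype]
    refine Finset.measurable_fun_sum _ fun c _ => (h s c).mul ?_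
    refine Finset.measurable_fun_sum _ fun w _ => ?_
    split_ifs
    exacts [ih _ _, measurable_const]

/-- The probability that a player who only observes her own actions plays the sequence `i`. -/
def reachProb (hH : 0 < H) (π : Policy (ActionNode C H) C) (i : List.Vector C H) : ℝ :=
  (actionLaw π H (ActionNode.root hH) i).toReal

variable (hH : 0 < H)

theorem reachProb_nonneg (π : Policy (ActionNode C H) C) (i : List.Vector C H) :
    0 ≤ reachProb hH π i := ENNReal.toReal_nonneg

theorem reachProb_le_one (π : Policy (ActionNode C H) C) (i : List.Vector C H) :
    reachProb hH π i ≤ 1 :=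
  ENNReal.toReal_le_of_le_ofReal one_pos.le (by simpa using PMF.coe_le_one _ _)

theorem sum_reachProb [Fintype C] (π : Policy (ActionNode C H) C) : ∑ i, reachProb hH π i = 1 :=
  PMF.sum_toReal _

theorem exists_reachProb_eq_one [Inhabited C] (i : List.Vector C H) :
    ∃ π : Policy (ActionNode C H) C, reachProb hH π i = 1 := by
  obtain ⟨π, h⟩ := exists_actionLaw_eq_pure i hH
  exact ⟨π, by simp [reachProb, h]⟩

theorem measurable_reachProb [Fintype C] {Ω : Type} [MeasurableSpace Ω]
    {π : Ω → Policy (ActionNode C H) C} (h : ∀ s c, Measurable fun ω => π ω s c)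
    (i : List.Vector C H) : Measurable fun ω => reachProb hH (π ω) i :=
  (measurable_actionLaw h _ _ _).ennreal_toReal

end ActionLaw

/-! ### Reduction of the game to a bandit -/

section Simultaneous

variable {A B : Type} {H : ℕ}

/-- Both players' policies as a policy of one player who chooses pairs of actions. -/
def jointPolicy (μ : Policy (ActionNode A H) A) (ν : Policy (ActionNode B H) B) :
    Policy (ActionNode (A × B) H) (A × B) :=
  fun s => (μ (s.map Prod.fst)).bind fun a => (ν (s.map Prod.snd)).map fun b => (a, b)

theorem jointPolicy_map_fst (μ : Policy (ActionNode A H) A) (ν : Policy (ActionNode B H) B)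
    (s : ActionNode (A × B) H) : (jointPolicy μ ν s).map Prod.fst = μ (s.map Prod.fst) := by
  simp only [jointPolicy, PMF.map_bind, PMF.map_comp]
  exact (congrArg _ (funext fun a => PMF.map_const _ a)).trans (PMF.bind_pure _)

theorem jointPolicy_map_snd (μ : Policy (ActionNode A H) A) (ν : Policy (ActionNode B H) B)
    (s : ActionNode (A × B) H) : (jointPolicy μ ν s).map Prod.snd = ν (s.map Prod.snd) := by
  simp only [jointPolicy, PMF.map_bind, PMF.map_comp]
  exact (congrArg _ (funext fun a => PMF.map_id _)).trans (PMF.bind_const _ _)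

theorem measurable_jointPolicy [Fintype A] [Fintype B] {Ω : Type} [MeasurableSpace Ω]
    {μ : Ω → Policy (ActionNode A H) A} {ν : Ω → Policy (ActionNode B H) B}
    (hμ : ∀ s c, Measurable fun ω => μ ω s c) (hν : ∀ s c, Measurable fun ω => ν ω s c)
    (s : ActionNode (A × B) H) (c : A × B) :
    Measurable fun ω => jointPolicy (μ ω) (ν ω) s c := by
  classical
  simp only [jointPolicy, PMF.bind_apply, PMF.map_apply, tsum_fintype]
  refine Finset.measurable_fun_sum _ fun a _ => (hμ _ a).mul ?_
  refine Finset.measurable_fun_sum _ fun b _ => ?_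
  split_ifs
  exacts [hν _ _, measurable_const]

/-- The reward that is the outcome of a coin. -/
def coinReward (b : Bool) : unitInterval := if b then 1 else 0

/-- A coin is tossed after the last step; its mean `q` depends on all actions. -/
def finalReward (H : ℕ) (q : List (A × B) → unitInterval) :
    Rewards (ActionNode (A × B) H) A B := fun s a b =>
  if s.1.length + 1 = H then (PMF.coin (q (s.1 ++ [(a, b)]))).map coinReward else PMF.pure 0

/-- The game on `simultaneousForm` with rewards `finalReward`. -/
def simultaneousGame (hH : 0 < H) (q : List (A × B) → unitInterval) :
    Game H (ActionNode (A × B) H) (ActionNode A H) (ActionNode B H) A B :=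
  ⟨simultaneousForm hH A B, finalReward H q⟩

theorem simultaneousGame_runFrom_succ (hH : 0 < H) (q : List (A × B) → unitInterval)
    (μ : Policy (ActionNode A H) A) (ν : Policy (ActionNode B H) B) (n : ℕ)
    (s : ActionNode (A × B) H) :
    (simultaneousGame hH q).runFrom μ ν (n + 1) s =
      (μ (s.map Prod.fst)).bind fun a => (ν (s.map Prod.snd)).bind fun b =>
        (finalReward H q s a b).bind fun r =>
          ((simultaneousGame hH q).runFrom μ ν n (s.next (a, b))).map fun τ =>
            (s, a, b, r) :: τ := by
  change ((μ (s.map Prod.fst)).bind fun a => (ν (s.map Prod.snd)).bind fun b =>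
    (finalReward H q s a b).bind fun r => (PMF.pure (s.next (a, b))).bind fun s' =>
      ((simultaneousGame hH q).runFrom μ ν n s').map fun τ => (s, a, b, r) :: τ) = _
  simp only [PMF.pure_bind]

/-- The trajectory from `s` with the actions `l` and the final reward `r`. -/
def pathTrajectory : ActionNode (A × B) H → List (A × B) → unitInterval →
    Trajectory (ActionNode (A × B) H) A B
  | _, [], _ => []
  | s, c :: l, r => (s, c.1, c.2, if l.isEmpty then r else 0) :: pathTrajectory (s.next c) l r

theorem sum_pathTrajectory (s : ActionNode (A × B) H) (l : List (A × B)) (r : unitInterval) :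
    ((pathTrajectory s l r).map fun q => (q.2.2.2 : ℝ)).sum =
      if l.isEmpty then 0 else (r : ℝ) := by
  induction l generalizing s with
  | nil => simp [pathTrajectory]
  | cons c l ih =>
    simp only [pathTrajectory, List.map_cons, List.sum_cons, ih]
    cases l <;> simp

/-- Transitions are deterministic and earlier rewards are 0, so only the actions and one coin are
random. The hypothesis `hs` makes the run end with the toss. -/
theorem simultaneousGame_runFrom (hH : 0 < H) (q : List (A × B) → unitInterval)
    (μ : Policy (ActionNode A H) A) (ν : Policy (ActionNode B H) B) (n : ℕ)
    (s : ActionNode (A × B) H) (hs : s.1.length + n = H) :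
    (simultaneousGame hH q).runFrom μ ν n s =
      (actionLaw (jointPolicy μ ν) n s).bind fun v =>
        (PMF.coin (q (s.1 ++ v.toList))).map fun b =>
          pathTrajectory s v.toList (coinReward b) := by
  induction n generalizing s with
  | zero =>
    simp only [Game.runFrom, actionLaw, PMF.pure_bind]
    exact (PMF.map_const _ _).symm
  | succ n ih =>
    simp only [simultaneousGame_runFrom_succ, actionLaw, jointPolicy, PMF.bind_bind, PMF.bind_map,
      Function.comp_def]
    congr 1; funext a
    congr 1; funext b
    -- The last step tosses the coin; any earlier step pays 0 and really advances the node.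
    rcases n with _ | n
    · have h1 : s.1.length + 1 = H := by omega
      simp only [finalReward, h1, if_true, Game.runFrom, actionLaw, PMF.pure_bind, PMF.pure_map,
        PMF.bind_map, List.Vector.toList_cons, pathTrajectory, List.Vector.toList_nil]
      rw [← PMF.bind_pure_comp]
      rfl
    · have h1 : s.1.length + 1 ≠ H := by omega
      have h2 : s.1.length + 1 < H := by omega
      simp only [finalReward, h1, if_false, PMF.pure_bind]
      have := ih (s.next (a, b)) (by rw [ActionNode.next_val h2]; simp; omega)
      rw [this, PMF.map_bind]
      congr 1; funext v
      rw [PMF.map_comp, ActionNode.next_val h2]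
      simp [Function.comp_def, pathTrajectory]

/-- The trajectory of an episode. -/
def episodeTrajectory (hH : 0 < H) (e : List.Vector (A × B) H × Bool) :
    Trajectory (ActionNode (A × B) H) A B :=
  pathTrajectory (ActionNode.root hH) e.1.toList (coinReward e.2)

theorem simultaneousGame_episode (hH : 0 < H) (q : List (A × B) → unitInterval)
    (μ : Policy (ActionNode A H) A) (ν : Policy (ActionNode B H) B) :
    (simultaneousGame hH q).episode μ ν =
      (actionLaw (jointPolicy μ ν) H (ActionNode.root hH)).bind fun v =>
        (PMF.coin (q v.toList)).map fun b => episodeTrajectory hH (v, b) := by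
  rw [Game.episode]
  change (PMF.pure _).bind _ = _
  rw [PMF.pure_bind, simultaneousGame_runFrom hH q μ ν H _ (by simp [ActionNode.root])]
  rfl

variable [Fintype A] [Fintype B]

theorem finite_support_episode (hH : 0 < H) (q : List (A × B) → unitInterval)
    (μ : Policy (ActionNode A H) A) (ν : Policy (ActionNode B H) B) :
    ((simultaneousGame hH q).episode μ ν).support.Finite := by
  rw [simultaneousGame_episode]
  exact PMF.finite_support_bind (Set.toFinite _) fun v =>
    PMF.finite_support_map (Set.toFinite _) _

theorem expect_episode (hH : 0 < H) (q : List (A × B) → unitInterval)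
    (μ : Policy (ActionNode A H) A) (ν : Policy (ActionNode B H) B)
    (f : Trajectory (ActionNode (A × B) H) A B → ℝ) :
    ((simultaneousGame hH q).episode μ ν).expect f =
      ∑ e : List.Vector (A × B) H × Bool,
        reachProb hH (jointPolicy μ ν) e.1 * coinProb (q e.1.toList) e.2 *
          f (episodeTrajectory hH e) := by
  rw [simultaneousGame_episode, PMF.expect_bind (Set.toFinite _) fun v =>
    PMF.finite_support_map (Set.toFinite _) _, PMF.expect_eq_sum_univ, Fintype.sum_prod_type]
  refine sum_congr rfl fun v _ => ?_
  rw [PMF.expect_map (Set.toFinite _), PMF.expect_eq_sum_univ, mul_sum]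
  refine sum_congr rfl fun b _ => ?_
  rw [PMF.coin_toReal, Function.comp_apply, reachProb, mul_assoc]

/-- The law of the actions in the next episode, if the policies are determined by the past through
`σ`. -/
def pathKernel (hH : 0 < H)
    (σ : List (Trajectory (ActionNode (A × B) H) A B) →
      Policy (ActionNode A H) A × Policy (ActionNode B H) B)
    (past : List (List.Vector (A × B) H × Bool)) (v : List.Vector (A × B) H) : ℝ :=
  reachProb hH (jointPolicy (σ (past.map (episodeTrajectory hH))).1
    (σ (past.map (episodeTrajectory hH))).2) v

theorem finite_support_play (hH : 0 < H) (q : List (A × B) → unitInterval)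
    (σ : List (Trajectory (ActionNode (A × B) H) A B) →
      Policy (ActionNode A H) A × Policy (ActionNode B H) B) (T : ℕ) :
    ((simultaneousGame hH q).play σ T).support.Finite := by
  induction T with
  | zero => simp [Game.play]
  | succ T ih =>
    exact PMF.finite_support_bind ih fun past =>
      PMF.finite_support_map (finite_support_episode hH q _ _) _

/-- The bridge from games to bandits: an episode is encoded by its action sequence and its coin, and
the policies see the past only through this code. -/
theorem expect_play (hH : 0 < H) (q : List (A × B) → unitInterval)
    (σ : List (Trajectory (ActionNode (A × B) H) A B) →
      Policy (ActionNode A H) A × Policy (ActionNode B H) B) (T : ℕ)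
    (f : List (Trajectory (ActionNode (A × B) H) A B) → ℝ) :
    ((simultaneousGame hH q).play σ T).expect f =
      adaptiveExpect (banditKernel (pathKernel hH σ) fun v => q v.toList) T
        fun past => f (past.map (episodeTrajectory hH)) := by
  induction T generalizing f with
  | zero => simp [Game.play, adaptiveExpect, PMF.expect_pure]
  | succ T ih =>
    rw [Game.play, PMF.expect_bind (finite_support_play hH q σ T) fun past =>
      PMF.finite_support_map (finite_support_episode hH q _ _) _, ih, adaptiveExpect]
    congr 1; funext past
    rw [PMF.expect_map (finite_support_episode hH q _ _), expect_episode]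
    simp [banditKernel, pathKernel, mul_assoc]

theorem value_eq_sum (hH : 0 < H) (q : List (A × B) → unitInterval)
    (μ : Policy (ActionNode A H) A) (ν : Policy (ActionNode B H) B) :
    (simultaneousGame hH q).value μ ν =
      ∑ v, reachProb hH (jointPolicy μ ν) v * q v.toList := by
  rw [Game.value, expect_episode, Fintype.sum_prod_type]
  refine sum_congr rfl fun v _ => ?_
  have hv : v.toList.isEmpty = false := by
    rw [List.isEmpty_eq_false_iff]
    intro h
    have := congrArg List.length h
    simp at this
    omega
  simp only [episodeTrajectory, sum_pathTrajectory, hv]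
  simp [coinReward, coinProb]

/-- If the mean of the coin only depends on one player's actions, and is special for the sequence
`i`, then the value is determined by the probability that this player plays `i`. -/
theorem value_eq_of_armMean {C : Type} [Fintype C] [DecidableEq C] (hH : 0 < H)
    {q : List (A × B) → unitInterval} {π : A × B → C} {δ : ℝ} {i : List.Vector C H}
    (hq : ∀ v : List.Vector (A × B) H, (q v.toList : ℝ) = armMean δ i (v.map π))
    {μ : Policy (ActionNode A H) A} {ν : Policy (ActionNode B H) B}
    {ρ : Policy (ActionNode C H) C} (hρ : ∀ s, (jointPolicy μ ν s).map π = ρ (s.map π)) :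
    (simultaneousGame hH q).value μ ν = 1 / 2 - δ / 2 + δ * reachProb hH ρ i := by
  have h1 : reachProb hH ρ i =
      ∑ v, if v.map π = i then reachProb hH (jointPolicy μ ν) v else 0 := by
    have := actionLaw_map hρ H (ActionNode.root hH)
    rw [reachProb, show ActionNode.root hH = (ActionNode.root hH).map π from rfl, ← this,
      PMF.toReal_map]
    rfl
  rw [value_eq_sum, h1, mul_sum]
  have h2 : ∀ v, reachProb hH (jointPolicy μ ν) v * (q v.toList : ℝ) =
      (1 / 2 - δ / 2) * reachProb hH (jointPolicy μ ν) v +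
        δ * if v.map π = i then reachProb hH (jointPolicy μ ν) v else 0 := fun v => by
    rw [hq, armMean]
    split_ifs <;> ring
  rw [sum_congr rfl fun v _ => h2 v, sum_add_distrib, ← mul_sum, sum_reachProb, mul_one]

theorem ciSup_eq_of_forall_le {ι : Type} {g : ι → ℝ} (i : ι) (h : ∀ j, g j ≤ g i) :
    ⨆ j, g j = g i :=
  have : Nonempty ι := ⟨i⟩
  le_antisymm (ciSup_le h) (le_ciSup ⟨g i, Set.forall_mem_range.2 h⟩ i)

theorem ciInf_eq_of_forall_ge {ι : Type} {g : ι → ℝ} (i : ι) (h : ∀ j, g i ≤ g j) :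
    ⨅ j, g j = g i :=
  have : Nonempty ι := ⟨i⟩
  le_antisymm (ciInf_le ⟨g i, Set.forall_mem_range.2 h⟩ i) (le_ciInf h)

/-- The infimum is over a constant, as the min-player has no influence; the supremum is attained by
playing `i` with certainty. -/
theorem neGap_of_armMean_fst [DecidableEq A] [Inhabited A] [Inhabited B] (hH : 0 < H)
    {q : List (A × B) → unitInterval} {δ : ℝ} (hδ : 0 ≤ δ) {i : List.Vector A H}
    (hq : ∀ v : List.Vector (A × B) H, (q v.toList : ℝ) = armMean δ i (v.map Prod.fst))
    (μ : Policy (ActionNode A H) A) (ν : Policy (ActionNode B H) B) :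
    (simultaneousGame hH q).neGap μ ν = δ * (1 - reachProb hH μ i) := by
  obtain ⟨μ₀, h0⟩ := exists_reachProb_eq_one hH i
  have hv : ∀ μ ν, (simultaneousGame hH q).value μ ν = 1 / 2 - δ / 2 + δ * reachProb hH μ i :=
    fun μ ν => value_eq_of_armMean hH hq (jointPolicy_map_fst μ ν)
  simp only [Game.neGap, hv]
  rw [ciSup_eq_of_forall_le μ₀, ciInf_eq_of_forall_ge ν fun _ => le_rfl, h0]
  · ring
  · intro μ'
    rw [h0]
    gcongr
    exact reachProb_le_one hH μ' i

/-- With shift `-δ` the special sequence is the one the min-player wants. -/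
theorem neGap_of_armMean_snd [DecidableEq B] [Inhabited A] [Inhabited B] (hH : 0 < H)
    {q : List (A × B) → unitInterval} {δ : ℝ} (hδ : 0 ≤ δ) {i : List.Vector B H}
    (hq : ∀ v : List.Vector (A × B) H, (q v.toList : ℝ) = armMean (-δ) i (v.map Prod.snd))
    (μ : Policy (ActionNode A H) A) (ν : Policy (ActionNode B H) B) :
    (simultaneousGame hH q).neGap μ ν = δ * (1 - reachProb hH ν i) := by
  obtain ⟨ν₀, h0⟩ := exists_reachProb_eq_one hH i
  have hv : ∀ μ ν, (simultaneousGame hH q).value μ ν =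
      1 / 2 - -δ / 2 + -δ * reachProb hH ν i :=
    fun μ ν => value_eq_of_armMean hH hq (jointPolicy_map_snd μ ν)
  simp only [Game.neGap, hv]
  rw [ciSup_eq_of_forall_le μ fun _ => le_rfl, ciInf_eq_of_forall_ge ν₀, h0]
  · ring
  · intro ν'
    rw [h0]
    nlinarith [reachProb_le_one hH ν' i]

/-- The best fixed policy always plays `i`, whatever the opponent does. -/
theorem regret_of_armMean [DecidableEq A] [Inhabited A] (hH : 0 < H)
    {q : List (A × B) → unitInterval} {δ : ℝ} (hδ : 0 ≤ δ) {i : List.Vector A H}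
    (hq : ∀ v : List.Vector (A × B) H, (q v.toList : ℝ) = armMean δ i (v.map Prod.fst))
    (σ : List (Trajectory (ActionNode (A × B) H) A B) →
      Policy (ActionNode A H) A × Policy (ActionNode B H) B) (T : ℕ)
    (past : List (Trajectory (ActionNode (A × B) H) A B)) :
    (simultaneousGame hH q).regret σ T past =
      δ * (T - ∑ t ∈ range T, reachProb hH (σ (past.take t)).1 i) := by
  obtain ⟨μ₀, h0⟩ := exists_reachProb_eq_one hH i
  have hv : ∀ μ ν, (simultaneousGame hH q).value μ ν = 1 / 2 - δ / 2 + δ * reachProb hH μ i :=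
    fun μ ν => value_eq_of_armMean hH hq (jointPolicy_map_fst μ ν)
  simp only [Game.regret, hv]
  rw [ciSup_eq_of_forall_le μ₀]
  · simp only [add_sub_add_left_eq_sub, ← mul_sub, h0, ← mul_sum, sum_sub_distrib]
    simp
  · intro μ'
    rw [h0]
    gcongr
    exact reachProb_le_one hH μ' i

end Simultaneous

/-! ### Averaging over the special arm and the internal randomness -/

section AverageArm

theorem adaptiveExpect_mul_const_sub {E : Type} [Fintype E] {κ : List E → E → ℝ}
    (hκ : ∀ l, ∑ e, κ l e = 1) (T : ℕ) (a b : ℝ) (f : List E → ℝ) :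
    adaptiveExpect κ T (fun l => a * (b - f l)) = a * (b - adaptiveExpect κ T f) := by
  have : (fun l => a * (b - f l)) = fun l => a * (b + -1 * f l) := by funext l; ring
  rw [this, adaptiveExpect_const_mul, adaptiveExpect_add, adaptiveExpect_const hκ,
    adaptiveExpect_const_mul]
  ring

/-- The arm must not depend on `ω`, so one integrates before choosing it. -/
theorem exists_integral_le_of_sum_le {Ω ι : Type} [MeasurableSpace Ω] {P : Measure Ω}
    [IsProbabilityMeasure P] [Fintype ι] [Nonempty ι] {g : ι → Ω → ℝ}
    (hg : ∀ i, Integrable (g i) P) {c : ℝ} (h : ∀ ω, ∑ i, g i ω ≤ Fintype.card ι * c) :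
    ∃ i, ∫ ω, g i ω ∂P ≤ c := by
  have h1 : ∑ i, ∫ ω, g i ω ∂P ≤ ∑ _i : ι, c := by
    rw [← integral_finsetSum _ fun i _ => hg i]
    refine (integral_mono (integrable_finsetSum _ fun i _ => hg i) (integrable_const _) h).trans ?_
    simp
  obtain ⟨i, -, hi⟩ := exists_le_of_sum_le univ_nonempty h1
  exact ⟨i, hi⟩

variable {V ι Ω : Type} [Fintype V] [Fintype ι] [DecidableEq ι] [MeasurableSpace Ω]
  {P : Measure Ω} [IsProbabilityMeasure P] {arm : V → ι} {m : Ω → List (V × Bool) → V → ℝ}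
  {f : ι → Ω → List (V × Bool) → ℝ}

theorem integrable_adaptiveExpect_bandit (hm : ∀ ω l v, 0 ≤ m ω l v)
    (hm1 : ∀ ω l, ∑ v, m ω l v = 1) (hmm : ∀ l v, Measurable fun ω => m ω l v)
    (hf0 : ∀ i ω l, 0 ≤ f i ω l) (hf : ∀ ω l, ∑ i, f i ω l = 1)
    (hfm : ∀ i l, Measurable fun ω => f i ω l) {δ : ℝ} (hδ : |δ| ≤ 1) (T : ℕ) (i : ι) :
    Integrable (fun ω => adaptiveExpect
      (banditKernel (m ω) fun v => armMean δ i (arm v)) T (f i ω)) P := by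
  obtain ⟨h1, h2⟩ := abs_le.1 hδ
  have hκ : ∀ ω l e, 0 ≤ banditKernel (m ω) (fun v => armMean δ i (arm v)) l e := fun ω l e => by
    refine mul_nonneg (hm ω l _) (coinProb_nonneg ?_ ?_ _) <;> simp only [armMean] <;> split_ifs <;>
      linarith
  have hκ1 := fun ω => sum_banditKernel (hm1 ω) fun v => armMean δ i (arm v)
  refine Integrable.of_bound (measurable_adaptiveExpect
    (fun l e => (hmm l _).mul_const _) (hfm i) T).aestronglyMeasurable 1 (ae_of_all _ fun ω => ?_)
  rw [Real.norm_eq_abs, abs_le]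
  constructor
  · have := adaptiveExpect_mono (hκ ω) T (hf0 i ω)
    rw [adaptiveExpect_const (hκ1 ω)] at this
    linarith
  · rw [← adaptiveExpect_const (hκ1 ω) T 1]
    refine adaptiveExpect_mono (hκ ω) T fun l => ?_
    rw [← hf ω l]
    exact single_le_sum (fun j _ => hf0 j ω l) (mem_univ i)

/-- If the special arm is unknown, there is one for which the statistic `f i` is small. -/
theorem exists_arm_integral_ge [Nonempty ι] (hm : ∀ ω l v, 0 ≤ m ω l v)
    (hm1 : ∀ ω l, ∑ v, m ω l v = 1) (hmm : ∀ l v, Measurable fun ω => m ω l v)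
    (hf0 : ∀ i ω l, 0 ≤ f i ω l) (hf : ∀ ω l, ∑ i, f i ω l = 1)
    (hfm : ∀ i l, Measurable fun ω => f i ω l) {δ : ℝ} {T : ℕ} (hδ : |δ| ≤ 1)
    (hT : T = 0 ∨ |δ| ≤ 3 / 4) {u a : ℝ} (ha : 0 ≤ a)
    (hu : 1 + (if T = 0 then 0 else Fintype.card ι / 12 + 130 * δ ^ 2 * T) ≤
      Fintype.card ι * u) :
    ∃ i, a * (1 - u) ≤ ∫ ω, adaptiveExpect
      (banditKernel (m ω) fun v => armMean δ i (arm v)) T (fun l => a * (1 - f i ω l)) ∂P := by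
  have hint := integrable_adaptiveExpect_bandit (P := P) (arm := arm) hm hm1 hmm hf0 hf hfm hδ T
  obtain ⟨i, hi⟩ := exists_integral_le_of_sum_le hint (c := u) fun ω => by
    refine le_trans ?_ hu
    -- Without samples the sum is exactly 1, even for `|δ| = 1`, where the likelihood ratios
    -- degenerate.
    by_cases h0 : T = 0
    · subst h0
      simp [adaptiveExpect, hf]
    · simpa [h0, add_assoc] using sum_adaptiveExpect_bandit_le arm (m ω) (hm ω) (hm1 ω)
        (hT.resolve_left h0) (fun i => f i ω) (fun i => hf0 i ω) (hf ω) T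
  refine ⟨i, ?_⟩
  simp only [fun ω => adaptiveExpect_mul_const_sub
    (sum_banditKernel (hm1 ω) fun v => armMean δ i (arm v)) T a 1 (f i ω)]
  rw [integral_const_mul, integral_sub (integrable_const _) (hint i)]
  simp only [integral_const, probReal_univ, smul_eq_mul, mul_one]
  gcongr

/-- With few samples, the special arm cannot be identified. -/
theorem exists_arm_gap_ge (hm : ∀ ω l v, 0 ≤ m ω l v)
    (hm1 : ∀ ω l, ∑ v, m ω l v = 1) (hmm : ∀ l v, Measurable fun ω => m ω l v)
    (hf0 : ∀ i ω l, 0 ≤ f i ω l) (hf : ∀ ω l, ∑ i, f i ω l = 1)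
    (hfm : ∀ i l, Measurable fun ω => f i ω l) {T : ℕ} (hι : 2 ≤ Fintype.card ι) {ε : ℝ}
    (hε : 0 < ε) (hε1 : ε ≤ 1 / 2) (hT : T * ε ^ 2 ≤ Fintype.card ι / 25000) {s : ℝ}
    (hs : |s| = 1) :
    ∃ (δ : ℝ) (i : ι), 0 ≤ δ ∧ δ ≤ 1 ∧ ε ≤ ∫ ω, adaptiveExpect
      (banditKernel (m ω) fun v => armMean (s * δ) i (arm v)) T
        (fun l => δ * (1 - f i ω l)) ∂P := by
  have : Nonempty ι := Fintype.card_pos_iff.1 (by omega)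
  have hK : (2 : ℝ) ≤ Fintype.card ι := by exact_mod_cast hι
  have hs2 : s ^ 2 = 1 := by rw [← sq_abs, hs, one_pow]
  have habs : ∀ δ : ℝ, 0 ≤ δ → |s * δ| = δ := fun δ h => by
    rw [abs_mul, hs, one_mul, abs_of_nonneg h]
  -- Without samples, `δ = 1` and at least two arms give a gap of `1 * (1 - 1 / 2)`, which covers `ε
  -- = 1 / 2`.
  by_cases h0 : T = 0
  · obtain ⟨i, hi⟩ := exists_arm_integral_ge (P := P) (arm := arm) hm hm1 hmm hf0 hf hfm
      (δ := s * 1) (T := T) (u := 1 / 2) (a := 1) (by rw [habs 1 zero_le_one]) (.inl h0)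
      zero_le_one (by rw [if_pos h0]; linarith)
    exact ⟨1, i, zero_le_one, le_rfl, by linarith⟩
  have hT1 : (1 : ℝ) ≤ T := by exact_mod_cast Nat.one_le_iff_ne_zero.2 h0
  by_cases h1 : ε ≤ 1 / 4
  -- The gap is `3 * ε * (1 - 2 / 3) = ε`, and `δ = 3 * ε ≤ 3 / 4`.
  · obtain ⟨i, hi⟩ := exists_arm_integral_ge (P := P) (arm := arm) hm hm1 hmm hf0 hf hfm
      (δ := s * (3 * ε)) (T := T) (u := 2 / 3) (a := 3 * ε)
      (by rw [habs _ (by linarith)]; linarith)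
      (.inr (by rw [habs _ (by linarith)]; linarith)) (by linarith)
      (by rw [if_neg h0, mul_pow, hs2]; nlinarith)
    exact ⟨3 * ε, i, by linarith, by linarith, by linarith⟩
  -- Here `3 * ε` would exceed `3 / 4`. But `T ≥ 1` and `ε > 1 / 4` force at least 1562 arms, so
  -- success has probability at most `1 / 3`, and `δ = 3 / 4` gives the gap `1 / 2`.
  · have hT2 : (T : ℝ) ≤ Fintype.card ι / 1562 := by
      have : (1 / 16 : ℝ) ≤ ε ^ 2 := by nlinarith
      nlinarith
    obtain ⟨i, hi⟩ := exists_arm_integral_ge (P := P) (arm := arm) hm hm1 hmm hf0 hf hfm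
      (δ := s * (3 / 4)) (T := T) (u := 1 / 3) (a := 3 / 4)
      (by rw [habs _ (by norm_num)]; norm_num)
      (.inr (by rw [habs _ (by norm_num)])) (by norm_num)
      (by rw [if_neg h0, mul_pow, hs2]; linarith)
    exact ⟨3 / 4, i, by norm_num, by norm_num, by linarith⟩

end AverageArm

/-! ### Lower bounds in terms of the number of action sequences -/

section LowerBounds

/-- The mean of the final coin, if the sequence `i` of actions of one player is special. -/
def armCoin {C D : Type} [DecidableEq C] {H : ℕ} {δ : ℝ} (hδ : |δ| ≤ 1) (π : D → C)
    (i : List.Vector C H) (l : List D) : unitInterval :=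
  ⟨if l.map π = i.toList then 1 / 2 + δ / 2 else 1 / 2 - δ / 2, by
    obtain ⟨h1, h2⟩ := abs_le.1 hδ
    split_ifs <;> constructor <;> linarith⟩

theorem armCoin_toList {C D : Type} [DecidableEq C] {H : ℕ} {δ : ℝ} (hδ : |δ| ≤ 1) (π : D → C)
    (i : List.Vector C H) (v : List.Vector D H) :
    (armCoin hδ π i v.toList : ℝ) = armMean δ i (v.map π) := by
  simp only [armCoin, armMean, ← List.Vector.toList_map, List.Vector.toList_injective.eq_iff]

variable {A B H : ℕ} (hH : 0 < H) {Ω : Type} [MeasurableSpace Ω] (P : Measure Ω)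
  [IsProbabilityMeasure P]

/-- With the next lemma: the number of infosets times `A` lies between the number of arms and twice
that number. -/
theorem geom_sum_mul_le (hA : 2 ≤ A) : (∑ h ∈ range H, A ^ h) * A ≤ 2 * A ^ H := by
  obtain ⟨a, rfl⟩ : ∃ a, A = a + 2 := ⟨A - 2, by omega⟩
  induction H with
  | zero => simp
  | succ H ih =>
    have := Nat.mul_le_mul_left ((a + 2) ^ H) (Nat.le_add_left 2 a)
    rw [sum_range_succ, pow_succ, add_mul]
    linarith

theorem pow_le_geom_sum_mul (hH : 0 < H) : A ^ H ≤ (∑ h ∈ range H, A ^ h) * A := by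
  obtain ⟨n, rfl⟩ : ∃ n, H = n + 1 := ⟨H - 1, by omega⟩
  rw [pow_succ]
  exact Nat.mul_le_mul_right _ (single_le_sum (f := fun h => A ^ h) (fun _ _ => Nat.zero_le _)
    (by simp))

theorem exists_rewards_le_expectedRegret (hA : 2 ≤ A) {T : ℕ} (hT : A ^ H ≤ T)
    (alg : MaxAlgorithm Ω (ActionNode (Fin A) H) (Fin A)) :
    ∃ r : Rewards (ActionNode (Fin A × Fin 1) H) (Fin A) (Fin 1),
      ∀ opp : Ω → List (Trajectory (ActionNode (Fin A × Fin 1) H) (Fin A) (Fin 1)) →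
        Policy (ActionNode (Fin 1) H) (Fin 1),
      √((A : ℝ) ^ H * T) / 120 ≤
        Game.expectedRegret { toGameForm := simultaneousForm hH (Fin A) (Fin 1), reward := r }
          P alg opp T := by
  have : NeZero A := ⟨by omega⟩
  have hcard : (Fintype.card (List.Vector (Fin A) H) : ℝ) = (A : ℝ) ^ H := by simp [card_vector]
  have : Nonempty (List.Vector (Fin A) H) := ⟨List.Vector.replicate H 0⟩
  have hK : (2 : ℝ) ≤ (A : ℝ) ^ H := by
    exact_mod_cast hA.trans (Nat.le_self_pow hH.ne' A)
  have hT' : (A : ℝ) ^ H ≤ T := by exact_mod_cast hT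
  have hTpos : (0 : ℝ) < T := by linarith
  have hT0 : T ≠ 0 := by rintro rfl; simp at hTpos
  -- Chosen so that `130 * δ ^ 2 * T = 130 * K / 1600`. With `1 ≤ K / 2` and `K / 12` this stays
  -- below `2 * K / 3`, so the regret is at least `δ * T / 3`.
  set δ : ℝ := √((A : ℝ) ^ H / T) / 40 with hδdef
  have hδ0 : 0 ≤ δ := by positivity
  have hsq : √((A : ℝ) ^ H / T) ≤ 1 := Real.sqrt_le_one.2 ((div_le_one hTpos).2 hT')
  have hδ : |δ| ≤ 3 / 4 := by rw [abs_of_nonneg hδ0]; linarith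
  have hδ1 : |δ| ≤ 1 := by linarith
  have hδ2 : δ ^ 2 * T = (A : ℝ) ^ H / 1600 := by
    rw [hδdef, div_pow, Real.sq_sqrt (by positivity)]
    field_simp
    norm_num
  have hδ3 : δ * T = √((A : ℝ) ^ H * T) / 40 := by
    rw [hδdef, Real.sqrt_div (by positivity), Real.sqrt_mul (by positivity)]
    have : (T : ℝ) = √T * √T := (Real.mul_self_sqrt hTpos.le).symm
    have h0 : √(T : ℝ) ≠ 0 := (Real.sqrt_pos.2 hTpos).ne'
    field_simp
    rw [sq, ← this]
  -- Observations do not depend on the reward law, so they can be fixed, with a dummy reward, before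
  -- the special arm is known.
  let obs := (simultaneousGame hH fun _ : List (Fin A × Fin 1) => 0).maxObs
  let pol : Ω → List (Trajectory (ActionNode (Fin A × Fin 1) H) (Fin A) (Fin 1)) →
    Policy (ActionNode (Fin A) H) (Fin A) := fun ω past => alg.policy ω (past.map obs)
  let σ : Ω → List (Trajectory (ActionNode (Fin A × Fin 1) H) (Fin A) (Fin 1)) →
    Policy (ActionNode (Fin A) H) (Fin A) × Policy (ActionNode (Fin 1) H) (Fin 1) :=
    fun ω past => (pol ω past, fun _ => PMF.pure 0)
  -- The probability of playing `i`, averaged over the episodes; this has total mass one over `i`.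
  let f : List.Vector (Fin A) H → Ω → List (List.Vector (Fin A × Fin 1) H × Bool) → ℝ :=
    fun i ω l => (∑ t ∈ range T,
      reachProb hH (pol ω ((l.map (episodeTrajectory hH)).take t)) i) / T
  obtain ⟨i, hi⟩ := exists_arm_integral_ge (P := P) (m := fun ω => pathKernel hH (σ ω))
    (arm := List.Vector.map Prod.fst) (f := f)
    (fun _ _ _ => reachProb_nonneg _ _ _) (fun _ _ => sum_reachProb _ _)
    (fun l v => measurable_reachProb hH (measurable_jointPolicy
      (fun s c => alg.measurable_policy _ s c) fun s c => measurable_const) v)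
    (fun i ω l => div_nonneg (sum_nonneg fun _ _ => reachProb_nonneg _ _ _) hTpos.le)
    (fun ω l => by
      simp only [f, ← sum_div]
      rw [sum_comm]
      simp [sum_reachProb, hT0])
    (fun i l => (Finset.measurable_fun_sum _ fun t _ => measurable_reachProb hH
      (fun s c => alg.measurable_policy _ s c) i).div_const _)
    hδ1 (.inr hδ) (u := 2 / 3) (a := δ * T) (by positivity)
    (by rw [if_neg hT0, hcard, mul_assoc, hδ2]; linarith)
  refine ⟨finalReward H (armCoin hδ1 Prod.fst i), fun opp => ?_⟩
  obtain rfl : opp = fun _ _ _ => PMF.pure 0 := Subsingleton.elim _ _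
  have heq : Game.expectedRegret (simultaneousGame (B := Fin 1) hH (armCoin hδ1 Prod.fst i)) P alg
      (fun _ _ _ => PMF.pure 0) T = ∫ ω, adaptiveExpect (banditKernel (pathKernel hH (σ ω))
        fun v => armMean δ i (v.map Prod.fst)) T (fun l => δ * T * (1 - f i ω l)) ∂P := by
    simp only [Game.expectedRegret, expect_play,
      regret_of_armMean hH hδ0 (armCoin_toList hδ1 Prod.fst i), armCoin_toList]
    congr 1; funext ω
    congr 1; funext l
    simp only [f]
    field_simp
    rfl
  refine le_trans (le_of_eq ?_) (hi.trans heq.ge)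
  rw [hδ3]; ring

variable (alg : JointAlgorithm Ω (ActionNode (Fin A) H) (ActionNode (Fin B) H) (Fin A) (Fin B))

theorem exists_rewards_le_expectedNEGap_max (hA : 2 ≤ A) (hB : 1 ≤ B) {T : ℕ} {ε : ℝ} (hε : 0 < ε)
    (hε1 : ε ≤ 1 / 2) (hT : T * ε ^ 2 ≤ (A : ℝ) ^ H / 25000) :
    ∃ r : Rewards (ActionNode (Fin A × Fin B) H) (Fin A) (Fin B), ε ≤ Game.expectedNEGap
      { toGameForm := simultaneousForm hH (Fin A) (Fin B), reward := r } P alg T := by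
  have : NeZero A := ⟨by omega⟩
  have : NeZero B := ⟨by omega⟩
  have hcard : Fintype.card (List.Vector (Fin A) H) = A ^ H := by simp [card_vector]
  let obs := (simultaneousGame hH fun _ : List (Fin A × Fin B) => 0).jointObs
  obtain ⟨δ, i, hδ0, hδ1, hi⟩ := exists_arm_gap_ge (P := P) (ε := ε) (s := 1) (T := T)
    (m := fun ω => pathKernel hH fun past =>
      (alg.policyMax ω (past.map obs), alg.policyMin ω (past.map obs)))
    (arm := List.Vector.map Prod.fst)
    (f := fun i ω l => reachProb hH
      (alg.outputMax ω ((l.map (episodeTrajectory hH)).map obs)) i)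
    (fun _ _ _ => reachProb_nonneg _ _ _) (fun _ _ => sum_reachProb _ _)
    (fun l v => measurable_reachProb hH (measurable_jointPolicy
      (fun s c => alg.measurable_policyMax _ s c) fun s c => alg.measurable_policyMin _ s c) v)
    (fun _ _ _ => reachProb_nonneg _ _ _) (fun _ _ => sum_reachProb _ _)
    (fun i l => measurable_reachProb hH (fun s c => alg.measurable_outputMax _ s c) i)
    (by rw [hcard]; exact hA.trans (Nat.le_self_pow hH.ne' A)) hε hε1
    (by rw [hcard]; exact_mod_cast hT) abs_one
  simp only [one_mul] at hi
  have hδ : |δ| ≤ 1 := by rwa [abs_of_nonneg hδ0]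
  refine ⟨finalReward H (armCoin hδ Prod.fst i), hi.trans (le_of_eq ?_)⟩
  have hq := armCoin_toList hδ (Prod.fst : Fin A × Fin B → Fin A) i
  change _ = Game.expectedNEGap (simultaneousGame hH (armCoin hδ Prod.fst i)) P alg T
  simp only [Game.expectedNEGap, expect_play, hq, neGap_of_armMean_fst hH hδ0 hq]
  rfl

theorem exists_rewards_le_expectedNEGap_min (hA : 1 ≤ A) (hB : 2 ≤ B) {T : ℕ} {ε : ℝ} (hε : 0 < ε)
    (hε1 : ε ≤ 1 / 2) (hT : T * ε ^ 2 ≤ (B : ℝ) ^ H / 25000) :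
    ∃ r : Rewards (ActionNode (Fin A × Fin B) H) (Fin A) (Fin B), ε ≤ Game.expectedNEGap
      { toGameForm := simultaneousForm hH (Fin A) (Fin B), reward := r } P alg T := by
  have : NeZero A := ⟨by omega⟩
  have : NeZero B := ⟨by omega⟩
  have hcard : Fintype.card (List.Vector (Fin B) H) = B ^ H := by simp [card_vector]
  let obs := (simultaneousGame hH fun _ : List (Fin A × Fin B) => 0).jointObs
  -- The sign `s = -1` lowers the mean of the special sequence.
  obtain ⟨δ, i, hδ0, hδ1, hi⟩ := exists_arm_gap_ge (P := P) (ε := ε) (s := -1) (T := T)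
    (m := fun ω => pathKernel hH fun past =>
      (alg.policyMax ω (past.map obs), alg.policyMin ω (past.map obs)))
    (arm := List.Vector.map Prod.snd)
    (f := fun i ω l => reachProb hH
      (alg.outputMin ω ((l.map (episodeTrajectory hH)).map obs)) i)
    (fun _ _ _ => reachProb_nonneg _ _ _) (fun _ _ => sum_reachProb _ _)
    (fun l v => measurable_reachProb hH (measurable_jointPolicy
      (fun s c => alg.measurable_policyMax _ s c) fun s c => alg.measurable_policyMin _ s c) v)
    (fun _ _ _ => reachProb_nonneg _ _ _) (fun _ _ => sum_reachProb _ _)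
    (fun i l => measurable_reachProb hH (fun s c => alg.measurable_outputMin _ s c) i)
    (by rw [hcard]; exact hB.trans (Nat.le_self_pow hH.ne' B)) hε hε1
    (by rw [hcard]; exact_mod_cast hT) (by simp)
  simp only [neg_one_mul] at hi
  have hδ : |-δ| ≤ 1 := by rwa [abs_neg, abs_of_nonneg hδ0]
  refine ⟨finalReward H (armCoin hδ Prod.snd i), hi.trans (le_of_eq ?_)⟩
  have hq := armCoin_toList hδ (Prod.snd : Fin A × Fin B → Fin B) i
  change _ = Game.expectedNEGap (simultaneousGame hH (armCoin hδ Prod.snd i)) P alg T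
  simp only [Game.expectedNEGap, expect_play, hq, neGap_of_armMean_snd hH hδ0 hq]
  rfl

end LowerBounds

end

/-! ### The theorem -/

theorem theorem3 :
    ∃ c : ℝ, 0 < c ∧ ∀ H A : ℕ, 1 ≤ H → 2 ≤ A →
      -- regret lower bound
      (∃ (S X Y : Type) (_ : Fintype S) (_ : Fintype X) (_ : Fintype Y)
          (F : GameForm H S X Y (Fin A) (Fin 1)),
        F.IsIIEFG ∧ Fintype.card X = ∑ h ∈ Finset.range H, A ^ h ∧
        ∀ T : ℕ, Fintype.card X * A ≤ T →
        ∀ (Ω : Type) [MeasurableSpace Ω] (P : MeasureTheory.Measure Ω)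
          [MeasureTheory.IsProbabilityMeasure P] (alg : MaxAlgorithm Ω X (Fin A)),
        ∃ r : Rewards S (Fin A) (Fin 1),
        ∀ opp : Ω → List (Trajectory S (Fin A) (Fin 1)) → Policy Y (Fin 1),
          c * √((Fintype.card X : ℝ) * A * T) ≤
            Game.expectedRegret { toGameForm := F, reward := r } P alg opp T) ∧
      -- PAC lower bound for learning Nash equilibria
      (∀ B : ℕ, 1 ≤ B →
        ∃ (S X Y : Type) (_ : Fintype S) (_ : Fintype X) (_ : Fintype Y)
          (F : GameForm H S X Y (Fin A) (Fin B)),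
        F.IsIIEFG ∧ Fintype.card X = ∑ h ∈ Finset.range H, A ^ h ∧
        Fintype.card Y = ∑ h ∈ Finset.range H, B ^ h ∧
        ∀ (T : ℕ) (Ω : Type) [MeasurableSpace Ω] (P : MeasureTheory.Measure Ω)
          [MeasureTheory.IsProbabilityMeasure P] (alg : JointAlgorithm Ω X Y (Fin A) (Fin B))
          (ε : ℝ), 0 < ε → ε ≤ 1 / 2 →
        (T : ℝ) < c * ((Fintype.card X : ℝ) * A + (Fintype.card Y : ℝ) * B) / ε ^ 2 →
        ∃ r : Rewards S (Fin A) (Fin B),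
          ε ≤ Game.expectedNEGap { toGameForm := F, reward := r } P alg T) := by
  -- For the gap, `X * A + Y * B ≤ 4 * K` with `K` the larger number of sequences, and `4 / 100000 =
  -- 1 / 25000`. The regret bound has room to spare.
  refine ⟨1 / 100000, by norm_num, fun H A hH hA => ⟨?_, fun B hB => ?_⟩⟩
  · have : NeZero A := ⟨by omega⟩
    have hX : Fintype.card (ActionNode (Fin A) H) = ∑ h ∈ Finset.range H, A ^ h := by
      simpa using ActionNode.card_eq (C := Fin A) (H := H)
    refine ⟨ActionNode (Fin A × Fin 1) H, ActionNode (Fin A) H, ActionNode (Fin 1) H,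
      inferInstance, inferInstance, inferInstance, simultaneousForm hH (Fin A) (Fin 1),
      simultaneousForm_isIIEFG, hX, fun T hT Ω _ P _ alg => ?_⟩
    rw [hX] at hT ⊢
    obtain ⟨r, hr⟩ := exists_rewards_le_expectedRegret hH P hA
      ((pow_le_geom_sum_mul hH).trans hT) alg
    refine ⟨r, fun opp => le_trans ?_ (hr opp)⟩
    have h1 : ((∑ h ∈ Finset.range H, A ^ h : ℕ) : ℝ) * A ≤ 2 * (A : ℝ) ^ H := by
      exact_mod_cast geom_sum_mul_le hA
    calc _ ≤ 1 / 100000 * √(2 ^ 2 * ((A : ℝ) ^ H * T)) := by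
          refine mul_le_mul_of_nonneg_left (Real.sqrt_le_sqrt ?_) (by norm_num)
          have : (0 : ℝ) ≤ T := by positivity
          nlinarith [mul_le_mul_of_nonneg_right h1 this, pow_nonneg (Nat.cast_nonneg (α := ℝ) A) H,
            mul_nonneg (pow_nonneg (Nat.cast_nonneg (α := ℝ) A) H) this]
      _ ≤ _ := by
          rw [Real.sqrt_mul (by norm_num), Real.sqrt_sq (by norm_num)]
          linarith [Real.sqrt_nonneg ((A : ℝ) ^ H * T)]
  · have : NeZero A := ⟨by omega⟩
    have : NeZero B := ⟨by omega⟩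
    have hX : Fintype.card (ActionNode (Fin A) H) = ∑ h ∈ Finset.range H, A ^ h := by
      simpa using ActionNode.card_eq (C := Fin A) (H := H)
    have hY : Fintype.card (ActionNode (Fin B) H) = ∑ h ∈ Finset.range H, B ^ h := by
      simpa using ActionNode.card_eq (C := Fin B) (H := H)
    refine ⟨ActionNode (Fin A × Fin B) H, ActionNode (Fin A) H, ActionNode (Fin B) H,
      inferInstance, inferInstance, inferInstance, simultaneousForm hH (Fin A) (Fin B),
      simultaneousForm_isIIEFG, hX, hY, fun T Ω _ P _ alg ε hε hε1 hT => ?_⟩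
    rw [hX, hY, lt_div_iff₀ (by positivity)] at hT
    have hmono : ∀ {a b : ℕ}, a ≤ b → (∑ h ∈ Finset.range H, a ^ h) * a ≤
        (∑ h ∈ Finset.range H, b ^ h) * b := fun h =>
      Nat.mul_le_mul (Finset.sum_le_sum fun k _ => Nat.pow_le_pow_left h k) h
    -- The secret is given to the player with more actions, whose term dominates the sum.
    rcases le_total B A with hBA | hAB
    · refine exists_rewards_le_expectedNEGap_max hH P alg hA hB hε hε1 (hT.le.trans ?_)
      have h1 : ((∑ h ∈ Finset.range H, A ^ h : ℕ) : ℝ) * A ≤ 2 * (A : ℝ) ^ H := by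
        exact_mod_cast geom_sum_mul_le hA
      have h2 : ((∑ h ∈ Finset.range H, B ^ h : ℕ) : ℝ) * B ≤ 2 * (A : ℝ) ^ H := by
        exact_mod_cast (hmono hBA).trans (geom_sum_mul_le hA)
      linarith
    · have hB2 := hA.trans hAB
      refine exists_rewards_le_expectedNEGap_min hH P alg (by omega) hB2 hε hε1 (hT.le.trans ?_)
      have h1 : ((∑ h ∈ Finset.range H, A ^ h : ℕ) : ℝ) * A ≤ 2 * (B : ℝ) ^ H := by
        exact_mod_cast (hmono hAB).trans (geom_sum_mul_le hB2)
      have h2 : ((∑ h ∈ Finset.range H, B ^ h : ℕ) : ℝ) * B ≤ 2 * (B : ℝ) ^ H := by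
        exact_mod_cast geom_sum_mul_le hB2
      linarith
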